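/- For real $u>0$ let $\gamma_n(u)$ denote the generalised Stieltjes constants, defined by the Laurent expansion of the Hurwitz zeta function about $s=1$, $$\zeta(s,u)=\frac1{s-1}+\sum_{n=0}^\infty\frac{(-1)^n}{n!}\gamma_n(u)(s-1)^n ,$$ where $\zeta(s,u)$ is the analytic continuation to $\mathbb C\setminus\{1\}$ of $\sum_{n=0}^\infty (n+u)^{-s}$ ($\operatorname{Re}s>1$), and let $\gamma_n$ denote the Stieltjes constants, defined by the corresponding expansion $\zeta(s)=\frac1{s-1}+\sum_{n=0}^\infty\frac{(-1)^n}{n!}\gamma_n(s-1)^n$ of the Riemann zeta function. Then for every real $u>0$ $$\gamma_1(u)=\frac12\int_0^1\!\int_0^1\left[\frac{(xy)^{u-1}\log(xy)}{(1-xy)\log x\,\log y}-\frac{x^{u-1}}{(1-x)\log y}-\frac{y^{u-1}}{(1-y)\log x}-\frac1{\log x\,\log y}\right]dx\,dy ,$$ and in particular $$\gamma_1=\frac12\int_0^1\!\int_0^1\left[\frac{\log(xy)}{(1-xy)\log x\,\log y}-\frac{1}{(1-x)\log y}-\frac{1}{(1-y)\log x}-\frac1{\log x\,\log y}\right]dx\,dy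 ,$$ where the last integrand is symmetric in $x$ and $y$. In both formulas the integrand is Lebesgue integrable on $(0,1)\times(0,1)$. -/

import Mathlib

open Filter Topology MeasureTheory

/-- The Hurwitz zeta function `ζ(s, u)` for real `u > 0` and all complex `s ≠ 1`, i.e. the analytic
continuation of `∑ (n + u)⁻ˢ`. Mathlib's `HurwitzZeta.hurwitzZeta` is periodic in `u` with period
one and gives `ζ(s, a)` for the representative `a ∈ (0, 1]` of `u` modulo one; we remove the
finitely many terms `(u - 1)⁻ˢ, (u - 2)⁻ˢ, …, a⁻ˢ`, of which there are `⌈u⌉ - 1`. -/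
noncomputable def hurwitzZetaFull (u : ℝ) (s : ℂ) : ℂ :=
  HurwitzZeta.hurwitzZeta (u : UnitAddCircle) s -
    ∑ k ∈ Finset.range (⌈u⌉₊ - 1), 1 / ((u : ℂ) - (k + 1)) ^ s

/-- The coefficient of `(s - 1)ⁿ`, `n ≥ 0`, in the Laurent expansion about `s = 1` of a function
that is holomorphic on `ℂ \ {1}`. -/
noncomputable def laurentCoeffAtOne (f : ℂ → ℂ) (n : ℕ) : ℂ :=
  (2 * Real.pi * Complex.I)⁻¹ * ∮ z in C(1, 1), f z / (z - 1) ^ (n + 1)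

/-- The generalised Stieltjes constants `γ_n(u)`, `u > 0`, determined by
`ζ(s, u) = 1 / (s - 1) + ∑ (-1)ⁿ / n! * γ_n(u) * (s - 1)ⁿ`. -/
noncomputable def hurwitzStieltjes (n : ℕ) (u : ℝ) : ℂ :=
  (-1) ^ n * (n.factorial : ℂ) * laurentCoeffAtOne (hurwitzZetaFull u) n

/-- The Stieltjes constants `γ_n`, determined by
`ζ(s) = 1 / (s - 1) + ∑ (-1)ⁿ / n! * γ_n * (s - 1)ⁿ`. -/
noncomputable def stieltjesConstant (n : ℕ) : ℂ :=
  (-1) ^ n * (n.factorial : ℂ) * laurentCoeffAtOne riemannZeta n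

/-- The integrand of the double integral for `γ_1(u)`. -/
noncomputable def stieltjesIntegrand (u x y : ℝ) : ℝ :=
  (x * y) ^ (u - 1) * Real.log (x * y) / ((1 - x * y) * Real.log x * Real.log y)
    - x ^ (u - 1) / ((1 - x) * Real.log y)
    - y ^ (u - 1) / ((1 - y) * Real.log x)
    - 1 / (Real.log x * Real.log y)

/-- The integrand of the double integral for `γ_1`. -/
noncomputable def stieltjesIntegrandOne (x y : ℝ) : ℝ :=
  Real.log (x * y) / ((1 - x * y) * Real.log x * Real.log y)
    - 1 / ((1 - x) * Real.log y)
    - 1 / ((1 - y) * Real.log x)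
    - 1 / (Real.log x * Real.log y)

theorem ceil_sub_one_spec {u : ℝ} (hu : 0 < u) :
    0 < u - ((⌈u⌉₊ - 1 : ℕ) : ℝ) ∧ u - ((⌈u⌉₊ - 1 : ℕ) : ℝ) ≤ 1 := by
  have h1 : 1 ≤ ⌈u⌉₊ := Nat.ceil_pos.2 hu
  have h2 := Nat.ceil_lt_add_one hu.le
  have h3 := Nat.le_ceil u
  rw [Nat.cast_sub h1]
  push_cast
  constructor <;> linarith

/-- `hurwitzZetaFull` is given by the Dirichlet series where that converges. -/
theorem hasSum_hurwitzZetaFull {u : ℝ} (hu : 0 < u) {s : ℂ} (hs : 1 < s.re) :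
    HasSum (fun n : ℕ => 1 / ((n : ℂ) + u) ^ s) (hurwitzZetaFull u s) := by
  obtain ⟨h0, h1⟩ := ceil_sub_one_spec hu
  unfold hurwitzZetaFull
  generalize ⌈u⌉₊ - 1 = m at *
  have hper : ((u - (m : ℝ) : ℝ) : UnitAddCircle) = (u : UnitAddCircle) := by
    have hm : ((m : ℝ) : UnitAddCircle) = 0 := by
      rw [AddCircle.coe_eq_zero_iff]
      exact ⟨m, by simp⟩
    rw [AddCircle.coe_sub, hm, sub_zero]
  have key := HurwitzZeta.hasSum_hurwitzZeta_of_one_lt_re (a := u - (m : ℝ)) ⟨h0.le, h1⟩ hs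
  rw [hper, ← hasSum_nat_add_iff' m] at key
  convert! key using 1
  · ext n
    push_cast
    congr 2
    ring
  · congr 1
    rw [← Finset.sum_range_reflect]
    refine Finset.sum_congr rfl fun k hk => ?_
    have : k + 1 ≤ m := Finset.mem_range.1 hk
    rw [show m - 1 - k = m - (k + 1) by omega, Nat.cast_sub this]
    push_cast
    congr 2
    ring

theorem differentiable_hurwitzZetaFull_correction {u : ℝ} (hu : 0 < u) :
    Differentiable ℂ (fun s : ℂ =>
      ∑ k ∈ Finset.range (⌈u⌉₊ - 1), 1 / ((u : ℂ) - (k + 1)) ^ s) := by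
  obtain ⟨h0, -⟩ := ceil_sub_one_spec hu
  refine Differentiable.fun_sum fun k hk => ?_
  have hk1 : ((k + 1 : ℕ) : ℝ) ≤ ((⌈u⌉₊ - 1 : ℕ) : ℝ) := by
    exact_mod_cast Finset.mem_range.1 hk
  have hne : ((u : ℂ) - (k + 1)) ≠ 0 := by
    have : (u - (k + 1) : ℝ) ≠ 0 := by
      push_cast at hk1
      linarith
    exact_mod_cast this
  intro s
  refine (differentiableAt_const _).div (differentiableAt_id.const_cpow (Or.inl hne)) ?_
  simp [Complex.cpow_eq_zero_iff, hne]

/-- `hurwitzZetaFull u` is holomorphic on `ℂ \ {1}`. -/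
theorem differentiableAt_hurwitzZetaFull {u : ℝ} (hu : 0 < u) {s : ℂ} (hs : s ≠ 1) :
    DifferentiableAt ℂ (hurwitzZetaFull u) s :=
  (HurwitzZeta.differentiableAt_hurwitzZeta _ hs).sub
    (differentiable_hurwitzZetaFull_correction hu s)

/-- `hurwitzZetaFull u` has a simple pole of residue one at `s = 1`. -/
theorem hurwitzZetaFull_residue_one {u : ℝ} (hu : 0 < u) :
    Tendsto (fun s => (s - 1) * hurwitzZetaFull u s) (𝓝[≠] 1) (𝓝 1) := by
  have hc : Continuous (fun s : ℂ => (s - 1) *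
      ∑ k ∈ Finset.range (⌈u⌉₊ - 1), 1 / ((u : ℂ) - (k + 1)) ^ s) :=
    (continuous_id.sub continuous_const).mul
      (differentiable_hurwitzZetaFull_correction hu).continuous
  have h := (hc.tendsto (1 : ℂ)).mono_left (nhdsWithin_le_nhds (s := {1}ᶜ))
  have h2 := (HurwitzZeta.hurwitzZeta_residue_one (u : UnitAddCircle)).sub h
  simp only [sub_self, zero_mul, sub_zero] at h2
  refine h2.congr fun s => ?_
  simp only [hurwitzZetaFull]
  ring

/-- A function holomorphic on `ℂ \ {1}` with a simple pole of residue one at `1` has the Laurent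
expansion whose coefficients are `laurentCoeffAtOne`. -/
theorem hasSum_laurentCoeffAtOne {f : ℂ → ℂ} (hf : ∀ s ≠ 1, DifferentiableAt ℂ f s)
    (hres : Tendsto (fun s => (s - 1) * f s) (𝓝[≠] 1) (𝓝 1)) {s : ℂ} (hs : s ≠ 1) :
    HasSum (fun n : ℕ => laurentCoeffAtOne f n * (s - 1) ^ n) (f s - 1 / (s - 1)) := by
  set h : ℂ → ℂ := Function.update (fun s => (s - 1) * f s) 1 1 with hh
  have hne : ∀ z : ℂ, z ≠ 1 → h z = (z - 1) * f z := fun z hz => by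
    simp [hh, Function.update_of_ne hz]
  have h1 : h 1 = 1 := by simp [hh]
  have hd : DifferentiableOn ℂ h Set.univ := by
    rw [← Complex.differentiableOn_compl_singleton_and_continuousAt_iff
      (c := 1) Filter.univ_mem]
    refine ⟨fun z hz => ?_, by rw [hh, continuousAt_update_same]; exact hres⟩
    have hz1 : z ≠ 1 := hz.2
    have hev : h =ᶠ[𝓝 z] fun s => (s - 1) * f s := by
      filter_upwards [isOpen_ne.mem_nhds hz1] with w hw using hne w hw
    exact ((((differentiableAt_id.sub_const 1).mul (hf z hz1)).congr_of_eventuallyEq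
      hev)).differentiableWithinAt
  have hG : Differentiable ℂ (dslope h 1) :=
    differentiableOn_univ.1 ((Complex.differentiableOn_dslope Filter.univ_mem).2 hd)
  have hGne : ∀ z : ℂ, z ≠ 1 → dslope h 1 z = f z - 1 / (z - 1) := fun z hz => by
    have : z - 1 ≠ 0 := sub_ne_zero.2 hz
    rw [dslope_of_ne _ hz, slope_def_field, hne z hz, h1]
    field_simp
  have hps := (hG.hasFPowerSeriesOnBall 1 (R := 1) one_pos).hasSum (y := s - 1)
    (by simp)
  rw [add_sub_cancel, hGne s hs] at hps
  convert! hps using 1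
  ext n
  have hsph : ∀ z ∈ Metric.sphere (1 : ℂ) 1, z ≠ 1 := fun z hz hz1 => by
    simp [hz1] at hz
  rw [cauchyPowerSeries_apply, smul_eq_mul, laurentCoeffAtOne, mul_assoc, NNReal.coe_one]
  congr 1
  have hI : (∮ z in C(1, 1), f z / (z - 1) ^ (n + 1)) =
      ∮ z in C(1, 1), dslope h 1 z / (z - 1) ^ (n + 1) := by
    have hz0 : (∮ z in C((1 : ℂ), 1), (z - 1) ^ (-(n + 2 : ℤ))) = 0 :=
      circleIntegral.integral_sub_zpow_of_ne (by omega) _ _ _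
    have hc1 : CircleIntegrable (fun z => f z / (z - 1) ^ (n + 1)) 1 1 := by
      refine ContinuousOn.circleIntegrable zero_le_one fun z hz => ?_
      have hc : ContinuousAt (fun w : ℂ => (w - 1) ^ (n + 1)) z := by fun_prop
      exact ((hf z (hsph z hz)).continuousAt.div hc
        (pow_ne_zero _ (sub_ne_zero.2 (hsph z hz)))).continuousWithinAt
    have hc2 : CircleIntegrable (fun z : ℂ => (z - 1) ^ (-(n + 2 : ℤ))) 1 1 := by
      refine ContinuousOn.circleIntegrable zero_le_one fun z hz => ?_
      have hc : ContinuousAt (fun w : ℂ => w - 1) z := by fun_prop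
      exact (hc.zpow₀ _
        (Or.inl (sub_ne_zero.2 (hsph z hz)))).continuousWithinAt
    rw [← sub_zero (∮ z in C(1, 1), f z / (z - 1) ^ (n + 1)), ← hz0,
      ← circleIntegral.integral_sub hc1 hc2]
    refine circleIntegral.integral_congr zero_le_one fun z hz => ?_
    have hz1 : z - 1 ≠ 0 := sub_ne_zero.2 (hsph z hz)
    rw [hGne z (hsph z hz), zpow_neg, show (n + 2 : ℤ) = ((n + 2 : ℕ) : ℤ) by push_cast; ring,
      zpow_natCast]
    field_simp
    ring
  rw [hI, mul_comm, ← smul_eq_mul, ← circleIntegral.integral_smul]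
  refine circleIntegral.integral_congr zero_le_one fun z hz => ?_
  have hz1 : z - 1 ≠ 0 := sub_ne_zero.2 (hsph z hz)
  simp only [smul_eq_mul]
  rw [div_pow]
  field_simp
  ring

/-- The `hurwitzStieltjes n u` are the Laurent coefficients of the Hurwitz zeta function. -/
theorem hasSum_hurwitzStieltjes {u : ℝ} (hu : 0 < u) {s : ℂ} (hs : s ≠ 1) :
    HasSum (fun n : ℕ => (-1) ^ n / (n.factorial : ℂ) * hurwitzStieltjes n u * (s - 1) ^ n)
      (hurwitzZetaFull u s - 1 / (s - 1)) := by
  convert! hasSum_laurentCoeffAtOne (fun z hz => differentiableAt_hurwitzZetaFull hu hz)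
    (hurwitzZetaFull_residue_one hu) hs using 2 with n
  have hn : (n.factorial : ℂ) ≠ 0 := by exact_mod_cast n.factorial_ne_zero
  have h1 : ((-1 : ℂ) ^ n) * (-1) ^ n = 1 := by rw [← mul_pow]; simp
  rw [hurwitzStieltjes]
  field_simp
  linear_combination (laurentCoeffAtOne _ n) * h1

/-- The `stieltjesConstant n` are the Laurent coefficients of the Riemann zeta function. -/
theorem hasSum_stieltjesConstant {s : ℂ} (hs : s ≠ 1) :
    HasSum (fun n : ℕ => (-1) ^ n / (n.factorial : ℂ) * stieltjesConstant n * (s - 1) ^ n)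
      (riemannZeta s - 1 / (s - 1)) := by
  convert! hasSum_laurentCoeffAtOne (fun z hz => differentiableAt_riemannZeta hz)
    riemannZeta_residue_one hs using 2 with n
  have hn : (n.factorial : ℂ) ≠ 0 := by exact_mod_cast n.factorial_ne_zero
  have h1 : ((-1 : ℂ) ^ n) * (-1) ^ n = 1 := by rw [← mul_pow]; simp
  rw [stieltjesConstant]
  field_simp
  linear_combination (laurentCoeffAtOne _ n) * h1

/-! Put R(t) = e⁻ᵘᵗ/(1 - e⁻ᵗ) - e⁻ᵗ/t and K(b, a) = (R(a)e⁻ᵇ - R(a + b))/b. Under x = e⁻ᵃ, y = e⁻ᵇ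
the integrand times its Jacobian becomes K(a, b) + K(b, a) (`stieltjesIntegrand_exp_neg`), so the
claim reduces to ∬ K = γ₁(u) over the quadrant.

The two halves of K cannot be integrated separately, because 1/b is not integrable at 0. Inserting a
factor bˢ with s > 0 separates them: with M(s) = ∫ tˢ R(t) dt, the regularised integral is (Γ(s + 1)
M(0) - M(s))/s (`integral_rpow_mul_hurwitzDifferenceKernel`). Term-by-term Mellin transformation
gives M(s) = Γ(s + 1)(ζ(1 + s, u) - 1/s) (`hurwitzRemainderMoment_eq`), hence M(0) = γ₀(u). The
regularised integral is therefore Γ(s + 1) times a difference quotient of the regular part of ζ at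
1, which tends to γ₁(u) as s → 0⁺.

Passing to the limit under the integral needs an exponentially decaying bound on K
(`exists_abs_hurwitzDifferenceKernel_le`), which rests on a Lipschitz estimate for R; the same bound
gives integrability. -/

/-! ### Boundedness and Lipschitz continuity of 1/(1 - e⁻ᵗ) - 1/t -/

theorem sinh_le_self_mul_cosh {z : ℝ} (hz : 0 ≤ z) : Real.sinh z ≤ z * Real.cosh z := by
  have hd : ∀ x : ℝ, HasDerivAt (fun x => x * Real.cosh x - Real.sinh x) (x * Real.sinh x) x :=
    fun x => (((hasDerivAt_id x).mul (Real.hasDerivAt_cosh x)).sub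
      (Real.hasDerivAt_sinh x)).congr_deriv (by simp)
  have hm : MonotoneOn (fun x => x * Real.cosh x - Real.sinh x) (Set.Ici 0) := by
    refine monotoneOn_of_deriv_nonneg (convex_Ici 0)
      (fun x _ => (hd x).continuousAt.continuousWithinAt)
      (fun x _ => (hd x).differentiableAt.differentiableWithinAt) fun x hx => ?_
    rw [interior_Ici] at hx
    rw [(hd x).deriv]
    exact mul_nonneg hx.le (Real.sinh_nonneg_iff.2 hx.le)
  have := hm (Set.mem_Ici.2 le_rfl) (Set.mem_Ici.2 hz) hz
  simp only [zero_mul, Real.sinh_zero, sub_zero] at this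
  linarith

/-- The function `1 / (1 - e⁻ᵗ)` with its pole at the origin removed. -/
noncomputable def bernoulliRemainder (t : ℝ) : ℝ := 1 / (1 - Real.exp (-t)) - 1 / t

theorem one_sub_exp_neg_pos {t : ℝ} (ht : 0 < t) : 0 < 1 - Real.exp (-t) := by
  have : Real.exp (-t) < 1 := by rw [← Real.exp_zero]; gcongr; linarith
  linarith

theorem one_sub_exp_neg_le (t : ℝ) : 1 - Real.exp (-t) ≤ t := by
  have := Real.add_one_le_exp (-t)
  linarith

theorem abs_bernoulliRemainder_le {t : ℝ} (ht : 0 < t) : |bernoulliRemainder t| ≤ 1 := by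
  have h1 := one_sub_exp_neg_pos ht
  have h2 := one_sub_exp_neg_le t
  have h3 : (t + 1) * Real.exp (-t) ≤ 1 := by
    calc (t + 1) * Real.exp (-t) ≤ Real.exp t * Real.exp (-t) := by
          gcongr; exact Real.add_one_le_exp t
      _ = 1 := by rw [← Real.exp_add]; simp
  have h4 : 1 / t ≤ 1 / (1 - Real.exp (-t)) := one_div_le_one_div_of_le h1 h2
  have h5 : 1 / (1 - Real.exp (-t)) ≤ 1 + 1 / t := by
    rw [div_le_iff₀ h1]
    have : (1 + 1 / t) * (1 - Real.exp (-t)) = (t + 1 - (t + 1) * Real.exp (-t)) / t := by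
      field_simp
    rw [this, le_div_iff₀ ht]
    linarith
  rw [bernoulliRemainder, abs_le]
  constructor <;> linarith

theorem hasDerivAt_bernoulliRemainder {t : ℝ} (ht : 0 < t) :
    HasDerivAt bernoulliRemainder (1 / t ^ 2 - 1 / (2 * Real.sinh (t / 2)) ^ 2) t := by
  have h1 := one_sub_exp_neg_pos ht
  have hd : HasDerivAt (fun t : ℝ => 1 - Real.exp (-t)) (Real.exp (-t)) t := by
    simpa using ((hasDerivAt_neg t).exp).const_sub 1
  have h := (hd.inv h1.ne').sub (hasDerivAt_inv ht.ne')
  have he : bernoulliRemainder = fun t => (1 - Real.exp (-t))⁻¹ - t⁻¹ := by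
    ext t
    simp [bernoulliRemainder]
  rw [he]
  refine h.congr_deriv ?_
  -- This turns the derivative -e⁻ᵗ/(1 - e⁻ᵗ)² of the first summand into -1/(2 sinh(t/2))², which is
  -- comparable with 1/t².
  have h2 : (2 * Real.sinh (t / 2)) ^ 2 * Real.exp (-t) = (1 - Real.exp (-t)) ^ 2 := by
    have e1 : Real.exp (-t) = Real.exp (-(t / 2)) ^ 2 := by
      rw [← Real.exp_nat_mul]; congr 1; push_cast; ring
    have e2 : Real.exp (t / 2) * Real.exp (-(t / 2)) = 1 := by rw [← Real.exp_add]; simp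
    have e3 : 2 * Real.sinh (t / 2) * Real.exp (-(t / 2)) = 1 - Real.exp (-(t / 2)) ^ 2 := by
      rw [Real.sinh_eq]
      linear_combination e2
    rw [e1, ← e3]
    ring
  rw [← h2]
  have h3 : 0 < Real.sinh (t / 2) := Real.sinh_pos_iff.2 (by linarith)
  have h4 := Real.exp_pos (-t)
  field_simp
  ring

/-- With z = t/2, z ≤ sinh z makes the difference nonnegative, and sinh z ≤ z cosh z bounds it
above. Only uniformity in t matters, not the constant. -/
theorem abs_deriv_bernoulliRemainder_le {t : ℝ} (ht : 0 < t) :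
    |1 / t ^ 2 - 1 / (2 * Real.sinh (t / 2)) ^ 2| ≤ 1 := by
  have h1 : t / 2 ≤ Real.sinh (t / 2) := Real.self_le_sinh_iff.2 (by linarith)
  have h2 := sinh_le_self_mul_cosh (z := t / 2) (by linarith)
  have h3 := Real.cosh_sq (t / 2)
  set S := Real.sinh (t / 2)
  set D := Real.cosh (t / 2)
  have hS : 0 < S := by linarith
  have h4 : 1 / (2 * S) ^ 2 ≤ 1 / t ^ 2 :=
    one_div_le_one_div_of_le (by positivity) (by gcongr; linarith)
  have h5 : S ^ 2 ≤ (t / 2) ^ 2 * (S ^ 2 + 1) := by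
    rw [← h3, ← mul_pow]
    gcongr
  have h6 : 1 / t ^ 2 - 1 / (2 * S) ^ 2 ≤ 1 := by
    have : 1 / t ^ 2 - 1 / (2 * S) ^ 2 = (4 * S ^ 2 - t ^ 2) / (4 * S ^ 2 * t ^ 2) := by
      field_simp
      ring
    rw [this, div_le_one (by positivity)]
    nlinarith [mul_pos (pow_pos ht 2) (pow_pos hS 2)]
  rw [abs_le]
  constructor <;> linarith

theorem abs_bernoulliRemainder_sub_le {a b : ℝ} (ha : 0 < a) (hb : 0 < b) :
    |bernoulliRemainder a - bernoulliRemainder (a + b)| ≤ b := by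
  have := (convex_Ioi (0 : ℝ)).norm_image_sub_le_of_norm_hasDerivWithin_le (C := 1)
    (fun t ht => (hasDerivAt_bernoulliRemainder ht).hasDerivWithinAt)
    (fun t ht => abs_deriv_bernoulliRemainder_le ht)
    (show a + b ∈ Set.Ioi 0 from add_pos ha hb) (Set.mem_Ioi.2 ha)
  simpa [abs_of_pos hb] using this

/-! ### Decay and Lipschitz estimates for the remainder R -/

/-- The integral kernel `e⁻ᵘᵗ / (1 - e⁻ᵗ)` of the Hurwitz zeta function minus the kernel `e⁻ᵗ / t`
that accounts for the pole at `s = 1`. -/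
noncomputable def hurwitzRemainder (u t : ℝ) : ℝ :=
  Real.exp (-(u * t)) / (1 - Real.exp (-t)) - Real.exp (-t) / t

theorem hurwitzRemainder_eq (u t : ℝ) :
    hurwitzRemainder u t = Real.exp (-(u * t)) * bernoulliRemainder t +
      (Real.exp (-(u * t)) / t - Real.exp (-(1 * t)) / t) := by
  rw [hurwitzRemainder, bernoulliRemainder, one_mul]
  ring

theorem hasDerivAt_exp_neg_mul_div {t : ℝ} (ht : 0 < t) (v : ℝ) :
    HasDerivAt (fun v => Real.exp (-(v * t)) / t) (-Real.exp (-(v * t))) v := by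
  refine ((((hasDerivAt_id v).mul_const t).neg.exp).div_const t).congr_deriv ?_
  simp only [id_eq, one_mul, mul_neg, neg_div]
  rw [mul_div_cancel_right₀ _ ht.ne']
  rfl

/-- The mean value inequality is applied in the parameter v between 1 and u, not in t:
differentiating e⁻ᵛᵗ/t in v cancels the singular factor 1/t. -/
theorem abs_exp_div_sub_le {u t : ℝ} (ht : 0 < t) :
    |Real.exp (-(u * t)) / t - Real.exp (-(1 * t)) / t| ≤ Real.exp (-(min u 1 * t)) * |u - 1| := by
  refine (convex_Ici (min u 1)).norm_image_sub_le_of_norm_hasDerivWithin_le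
    (fun v _ => (hasDerivAt_exp_neg_mul_div ht v).hasDerivWithinAt)
    (fun v hv => ?_) (Set.mem_Ici.2 (min_le_right u 1)) (Set.mem_Ici.2 (min_le_left u 1))
  rw [norm_neg, Real.norm_of_nonneg (Real.exp_nonneg _)]
  have : min u 1 ≤ v := hv
  gcongr

theorem exp_neg_sub_exp_neg_le {c v a b : ℝ} (hcv : c ≤ v) (ha : 0 ≤ a) (hvb : 0 ≤ v * b) :
    Real.exp (-(v * a)) - Real.exp (-(v * (a + b))) ≤ Real.exp (-(c * a)) * (v * b) := by
  have h : Real.exp (-(v * (a + b))) = Real.exp (-(v * a)) * Real.exp (-(v * b)) := by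
    rw [← Real.exp_add]; congr 1; ring
  rw [h]
  calc _ = Real.exp (-(v * a)) * (1 - Real.exp (-(v * b))) := by ring
    _ ≤ Real.exp (-(v * a)) * (v * b) := by gcongr; exact one_sub_exp_neg_le _
    _ ≤ _ := by gcongr

/-- Again a mean value inequality in v. The v-derivative of the difference between a and a + b is
e⁻ᵛ⁽ᵃ⁺ᵇ⁾ - e⁻ᵛᵃ, which supplies the factor b. -/
theorem abs_exp_div_sub_sub_le {u a b : ℝ} (hu : 0 < u) (ha : 0 < a) (hb : 0 < b) :
    |(Real.exp (-(u * a)) / a - Real.exp (-(1 * a)) / a) -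
      (Real.exp (-(u * (a + b))) / (a + b) - Real.exp (-(1 * (a + b))) / (a + b))| ≤
      Real.exp (-(min u 1 * a)) * (max u 1 * b) * |u - 1| := by
  have hab : 0 < a + b := add_pos ha hb
  have h := (convex_Icc (min u 1) (max u 1)).norm_image_sub_le_of_norm_hasDerivWithin_le
    (C := Real.exp (-(min u 1 * a)) * (max u 1 * b))
    (fun v _ => ((hasDerivAt_exp_neg_mul_div ha v).sub
      (hasDerivAt_exp_neg_mul_div hab v)).hasDerivWithinAt)
    (fun v hv => ?_) (Set.mem_Icc.2 ⟨min_le_right u 1, le_max_right u 1⟩)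
    (Set.mem_Icc.2 ⟨min_le_left u 1, le_max_left u 1⟩)
  · rw [Real.norm_eq_abs, Real.norm_eq_abs] at h
    convert! h using 2
    simp only [Pi.sub_apply]
    ring
  · have hv0 : 0 < v := lt_of_lt_of_le (lt_min hu one_pos) hv.1
    have h0 : Real.exp (-(v * (a + b))) ≤ Real.exp (-(v * a)) := by
      gcongr; linarith
    rw [Real.norm_eq_abs, abs_sub_comm, abs_of_nonneg (by linarith)]
    have h1 := exp_neg_sub_exp_neg_le hv.1 ha.le (mul_pos hv0 hb).le
    have h2 : Real.exp (-(min u 1 * a)) * (v * b) ≤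
        Real.exp (-(min u 1 * a)) * (max u 1 * b) := by
      gcongr; exact hv.2
    linarith

theorem abs_hurwitzRemainder_le {u t : ℝ} (ht : 0 < t) :
    |hurwitzRemainder u t| ≤ (1 + |u - 1|) * Real.exp (-(min u 1 * t)) := by
  rw [hurwitzRemainder_eq]
  refine (abs_add_le _ _).trans ?_
  have h1 : |Real.exp (-(u * t)) * bernoulliRemainder t| ≤ Real.exp (-(min u 1 * t)) * 1 := by
    rw [abs_mul, abs_of_pos (Real.exp_pos _)]
    gcongr
    · exact min_le_left _ _
    · exact abs_bernoulliRemainder_le ht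
  have := abs_exp_div_sub_le (u := u) ht
  linarith

/-- The factor b here compensates the division by b in the difference kernel. -/
theorem exists_abs_hurwitzRemainder_sub_le {u : ℝ} (hu : 0 < u) :
    ∃ C, 0 ≤ C ∧ ∀ a b : ℝ, 0 < a → 0 < b →
      |hurwitzRemainder u a - hurwitzRemainder u (a + b)| ≤
        C * b * Real.exp (-(min u 1 * a)) := by
  refine ⟨u + 1 + max u 1 * |u - 1|, by positivity, fun a b ha hb => ?_⟩
  have h1 := abs_exp_div_sub_sub_le hu ha hb
  have h2 := exp_neg_sub_exp_neg_le (min_le_left u 1) ha.le (mul_pos hu hb).le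
  have h0 : Real.exp (-(u * (a + b))) ≤ Real.exp (-(u * a)) := by
    gcongr; linarith
  have h0' : Real.exp (-(u * a)) ≤ Real.exp (-(min u 1 * a)) := by
    gcongr; exact min_le_left _ _
  have h3 : |(Real.exp (-(u * a)) - Real.exp (-(u * (a + b)))) * bernoulliRemainder a| ≤
      Real.exp (-(min u 1 * a)) * (u * b) * 1 := by
    rw [abs_mul, abs_of_nonneg (sub_nonneg.2 h0)]
    gcongr
    exact abs_bernoulliRemainder_le ha
  have h4 : |Real.exp (-(u * (a + b))) * (bernoulliRemainder a - bernoulliRemainder (a + b))| ≤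
      Real.exp (-(min u 1 * a)) * b := by
    rw [abs_mul, abs_of_pos (Real.exp_pos _)]
    exact mul_le_mul (h0.trans h0') (abs_bernoulliRemainder_sub_le ha hb) (abs_nonneg _)
      (Real.exp_nonneg _)
  rw [hurwitzRemainder_eq, hurwitzRemainder_eq]
  set p := Real.exp (-(u * a)) / a - Real.exp (-(1 * a)) / a
  set q := Real.exp (-(u * (a + b))) / (a + b) - Real.exp (-(1 * (a + b))) / (a + b)
  have e : Real.exp (-(u * a)) * bernoulliRemainder a + p -
      (Real.exp (-(u * (a + b))) * bernoulliRemainder (a + b) + q) =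
      (Real.exp (-(u * a)) - Real.exp (-(u * (a + b)))) * bernoulliRemainder a +
      Real.exp (-(u * (a + b))) * (bernoulliRemainder a - bernoulliRemainder (a + b)) +
      (p - q) := by ring
  rw [e]
  refine (abs_add_three _ _ _).trans ?_
  linarith

/-! ### Exponential bound for the difference kernel -/

/-- `(R(a) e⁻ᵇ - R(a + b)) / b` for `R = hurwitzRemainder u`. -/
noncomputable def hurwitzDifferenceKernel (u b a : ℝ) : ℝ :=
  (hurwitzRemainder u a * Real.exp (-b) - hurwitzRemainder u (a + b)) / b

theorem exists_abs_hurwitzDifferenceKernel_le {u : ℝ} (hu : 0 < u) :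
    ∃ C, 0 ≤ C ∧ ∀ b a : ℝ, 0 < b → 0 < a → |hurwitzDifferenceKernel u b a| ≤
      C * (Real.exp (-(min u 1 * b)) * Real.exp (-(min u 1 * a))) := by
  obtain ⟨C, hC, hR⟩ := exists_abs_hurwitzRemainder_sub_le hu
  set M := 1 + |u - 1| with hM
  have hM0 : 0 ≤ M := by positivity
  set c := min u 1 with hc
  have hc0 : 0 < c := lt_min hu one_pos
  have hc1 : c ≤ 1 := min_le_right _ _
  -- For b ≤ 1 the Lipschitz estimate gives M + C, and eᶜ pays for inserting e⁻ᶜᵇ. For b ≥ 1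
  -- dividing by b is harmless, and the two terms of the numerator give 2M.
  refine ⟨(M + C) * Real.exp c + 2 * M, by positivity, fun b a hb ha => ?_⟩
  have hRa := abs_hurwitzRemainder_le (u := u) ha
  have hRab := abs_hurwitzRemainder_le (u := u) (add_pos ha hb)
  rw [← hM, ← hc] at hRa hRab
  rw [hurwitzDifferenceKernel, abs_div, abs_of_pos hb, div_le_iff₀ hb]
  rcases le_total b 1 with h | h
  · have e : hurwitzRemainder u a * Real.exp (-b) - hurwitzRemainder u (a + b) =
      (hurwitzRemainder u a - hurwitzRemainder u (a + b)) -
        hurwitzRemainder u a * (1 - Real.exp (-b)) := by ring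
    have h1 : |hurwitzRemainder u a * (1 - Real.exp (-b))| ≤ M * Real.exp (-(c * a)) * b := by
      rw [abs_mul, abs_of_pos (one_sub_exp_neg_pos hb)]
      exact mul_le_mul hRa (one_sub_exp_neg_le b) (one_sub_exp_neg_pos hb).le (by positivity)
    have h2 := hR a b ha hb
    rw [e]
    have h3 : 1 ≤ Real.exp c * Real.exp (-(c * b)) := by
      rw [← Real.exp_add]
      refine Real.one_le_exp ?_
      nlinarith
    calc _ ≤ _ := abs_sub _ _
      _ ≤ (M + C) * 1 * Real.exp (-(c * a)) * b := by linarith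
      _ ≤ (M + C) * (Real.exp c * Real.exp (-(c * b))) * Real.exp (-(c * a)) * b := by gcongr
      _ = (M + C) * Real.exp c * (Real.exp (-(c * b)) * Real.exp (-(c * a))) * b := by ring
      _ ≤ _ := by gcongr; linarith
  · have e : Real.exp (-(c * (a + b))) = Real.exp (-(c * b)) * Real.exp (-(c * a)) := by
      rw [← Real.exp_add]; congr 1; ring
    have h1 : |hurwitzRemainder u a * Real.exp (-b)| ≤
        M * (Real.exp (-(c * b)) * Real.exp (-(c * a))) := by
      rw [abs_mul, abs_of_pos (Real.exp_pos _)]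
      calc _ ≤ M * Real.exp (-(c * a)) * Real.exp (-(c * b)) := by
            gcongr
            nlinarith
        _ = _ := by ring
    rw [e] at hRab
    set E := Real.exp (-(c * b)) * Real.exp (-(c * a)) with hE
    have hE0 : 0 < E := by positivity
    calc _ ≤ _ := abs_sub _ _
      _ ≤ 2 * M * E * 1 := by linarith
      _ ≤ _ := by gcongr; linarith [show 0 ≤ (M + C) * Real.exp c by positivity]

/-! ### Moments of R and their continuity at zero -/

theorem measurable_hurwitzRemainder (u : ℝ) : Measurable (hurwitzRemainder u) := by
  unfold hurwitzRemainder
  fun_prop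

theorem integrableOn_rpow_mul_exp_neg_mul {s c : ℝ} (hs : -1 < s) (hc : 0 < c) :
    IntegrableOn (fun t : ℝ => t ^ s * Real.exp (-(c * t))) (Set.Ioi 0) := by
  simpa using integrableOn_rpow_mul_exp_neg_mul_rpow hs one_pos hc

theorem integrableOn_exp_neg_mul {c : ℝ} (hc : 0 < c) :
    IntegrableOn (fun t : ℝ => Real.exp (-(c * t))) (Set.Ioi 0) := by
  simpa using integrableOn_rpow_mul_exp_neg_mul (s := 0) (by norm_num) hc

/-- Supplies a dominating function independent of s for the limits s → 0⁺. -/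
theorem rpow_le_one_add {t s : ℝ} (ht : 0 < t) (hs0 : 0 ≤ s) (hs1 : s ≤ 1) : t ^ s ≤ 1 + t := by
  rcases le_total t 1 with h | h
  · exact (Real.rpow_le_one ht.le h hs0).trans (by linarith)
  · calc t ^ s ≤ t ^ (1 : ℝ) := Real.rpow_le_rpow_of_exponent_le h hs1
      _ ≤ 1 + t := by rw [Real.rpow_one]; linarith

theorem integrableOn_one_add_mul_exp_neg_mul {c : ℝ} (hc : 0 < c) :
    IntegrableOn (fun t : ℝ => (1 + t) * Real.exp (-(c * t))) (Set.Ioi 0) := by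
  have h := (integrableOn_exp_neg_mul hc).add
    (integrableOn_rpow_mul_exp_neg_mul (s := 1) (by norm_num) hc)
  refine h.congr_fun (fun t _ => ?_) measurableSet_Ioi
  simp only [Pi.add_apply, Real.rpow_one]
  ring

theorem integrableOn_rpow_mul_hurwitzRemainder {u s : ℝ} (hu : 0 < u) (hs : -1 < s) :
    IntegrableOn (fun t : ℝ => t ^ s * hurwitzRemainder u t) (Set.Ioi 0) := by
  refine Integrable.mono'
    ((integrableOn_rpow_mul_exp_neg_mul hs (lt_min hu one_pos)).const_mul (1 + |u - 1|))
    ((measurable_id.pow_const s).mul (measurable_hurwitzRemainder u)).aestronglyMeasurable ?_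
  filter_upwards [ae_restrict_mem measurableSet_Ioi] with t ht
  have ht0 : 0 < t := ht
  rw [norm_mul, Real.norm_of_nonneg (Real.rpow_nonneg ht0.le s)]
  calc _ ≤ t ^ s * ((1 + |u - 1|) * Real.exp (-(min u 1 * t))) := by
        gcongr; exact abs_hurwitzRemainder_le ht0
    _ = _ := by ring

/-- The Mellin transform of `hurwitzRemainder u` at `s + 1`. -/
noncomputable def hurwitzRemainderMoment (u s : ℝ) : ℝ :=
  ∫ t in Set.Ioi (0 : ℝ), t ^ s * hurwitzRemainder u t

theorem tendsto_hurwitzRemainderMoment {u : ℝ} (hu : 0 < u) :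
    Tendsto (hurwitzRemainderMoment u) (𝓝[>] 0) (𝓝 (hurwitzRemainderMoment u 0)) := by
  refine tendsto_integral_filter_of_dominated_convergence
    (fun t => (1 + |u - 1|) * ((1 + t) * Real.exp (-(min u 1 * t)))) ?_ ?_
    ((integrableOn_one_add_mul_exp_neg_mul (lt_min hu one_pos)).const_mul _) ?_
  · exact Eventually.of_forall fun s =>
      ((measurable_id.pow_const s).mul (measurable_hurwitzRemainder u)).aestronglyMeasurable
  · filter_upwards [Ioc_mem_nhdsGT (one_pos (α := ℝ))] with s hs
    filter_upwards [ae_restrict_mem measurableSet_Ioi] with t ht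
    have ht0 : 0 < t := ht
    rw [norm_mul, Real.norm_of_nonneg (Real.rpow_nonneg ht0.le s)]
    calc _ ≤ (1 + t) * ((1 + |u - 1|) * Real.exp (-(min u 1 * t))) :=
          mul_le_mul (rpow_le_one_add ht0 hs.1.le hs.2) (abs_hurwitzRemainder_le ht0)
            (abs_nonneg _) (by linarith)
      _ = _ := by ring
  · filter_upwards [ae_restrict_mem measurableSet_Ioi] with t ht
    have ht0 : t ≠ 0 := ne_of_gt ht
    exact (((Real.continuousAt_const_rpow ht0).tendsto).mono_left nhdsWithin_le_nhds).mul_const _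

/-! ### Mellin transform and the Hurwitz zeta function -/

theorem hasSum_exp_neg_mul_nat_add {u t : ℝ} (ht : 0 < t) :
    HasSum (fun n : ℕ => Real.exp (-(n + u) * t))
      (Real.exp (-(u * t)) / (1 - Real.exp (-t))) := by
  have h := (hasSum_geometric_of_lt_one (Real.exp_nonneg (-t))
    (by linarith [one_sub_exp_neg_pos ht])).mul_left (Real.exp (-(u * t)))
  convert! h using 1
  ext n
  rw [← Real.exp_nat_mul, ← Real.exp_add]
  congr 1
  ring

theorem mellin_hurwitz_kernel {u : ℝ} (hu : 0 < u) {s : ℂ} (hs : 1 < s.re) :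
    mellin (fun t : ℝ => ((Real.exp (-(u * t)) / (1 - Real.exp (-t)) : ℝ) : ℂ)) s =
      Complex.Gamma s * hurwitzZetaFull u s := by
  have hp : ∀ n : ℕ, (0 : ℝ) < n + u := fun n => by positivity
  have h := hasSum_mellin (a := fun _ : ℕ => (1 : ℂ)) (p := fun n : ℕ => n + u)
    (F := fun t : ℝ => ((Real.exp (-(u * t)) / (1 - Real.exp (-t)) : ℝ) : ℂ)) (s := s)
    (fun n => Or.inr (hp n)) (by linarith) (fun t ht => ?_) ?_
  · refine h.unique ?_
    convert! (hasSum_hurwitzZetaFull hu hs).mul_left (Complex.Gamma s) using 2 with n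
    push_cast
    ring
  · simpa only [one_mul] using Complex.hasSum_ofReal.2 (hasSum_exp_neg_mul_nat_add ht)
  · refine ((Real.summable_one_div_nat_add_rpow u s.re).2 hs).congr fun n => ?_
    rw [abs_of_pos (hp n), norm_one]

/-- The subtracted kernel e⁻ᵗ/t contributes Γ(s) = Γ(s + 1)/s, which is exactly the polar term. -/
theorem hurwitzRemainderMoment_eq {u s : ℝ} (hu : 0 < u) (hs : 0 < s) :
    (hurwitzRemainderMoment u s : ℂ) =
      Real.Gamma (s + 1) * (hurwitzZetaFull u (1 + s) - 1 / s) := by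
  have hG : IntegrableOn (fun t : ℝ => Real.exp (-t) * t ^ (s - 1)) (Set.Ioi 0) :=
    Real.GammaIntegral_convergent hs
  have h1 : hurwitzRemainderMoment u s =
      (∫ t in Set.Ioi (0 : ℝ), t ^ s * (Real.exp (-(u * t)) / (1 - Real.exp (-t)))) -
        Real.Gamma s := by
    have : ∫ t in Set.Ioi (0 : ℝ), t ^ s * (Real.exp (-(u * t)) / (1 - Real.exp (-t))) =
        ∫ t in Set.Ioi (0 : ℝ),
          (t ^ s * hurwitzRemainder u t + Real.exp (-t) * t ^ (s - 1)) := by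
      refine setIntegral_congr_fun measurableSet_Ioi fun t ht => ?_
      have ht0 : 0 < t := ht
      simp only [hurwitzRemainder]
      rw [Real.rpow_sub_one ht0.ne']
      ring
    rw [this, integral_add (integrableOn_rpow_mul_hurwitzRemainder hu (by linarith)) hG,
      Real.Gamma_eq_integral hs, hurwitzRemainderMoment]
    ring
  have h2 : ((∫ t in Set.Ioi (0 : ℝ),
      t ^ s * (Real.exp (-(u * t)) / (1 - Real.exp (-t))) : ℝ) : ℂ) =
      Complex.Gamma (1 + s) * hurwitzZetaFull u (1 + s) := by
    rw [← mellin_hurwitz_kernel hu (by simpa using hs), mellin, ← integral_complex_ofReal]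
    refine setIntegral_congr_fun measurableSet_Ioi fun t ht => ?_
    have ht0 : (0 : ℝ) ≤ t := le_of_lt ht
    simp only [add_sub_cancel_left, smul_eq_mul]
    rw [Complex.ofReal_mul, Complex.ofReal_cpow ht0]
  have h3 : Real.Gamma (s + 1) = s * Real.Gamma s := Real.Gamma_add_one hs.ne'
  have h4 : Complex.Gamma (1 + s) = (Real.Gamma (s + 1) : ℝ) := by
    rw [← Complex.Gamma_ofReal]
    push_cast
    rw [add_comm]
  have hs0 : (s : ℂ) ≠ 0 := by exact_mod_cast hs.ne'
  rw [h1, Complex.ofReal_sub, h2, h4, h3]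
  push_cast
  field_simp

/-! ### Behaviour of the zeta function near its pole -/

/-- A convergent power series agrees with its affine part up to a quadratic error. -/
theorem exists_norm_sub_affine_le {c : ℕ → ℂ} {Z : ℂ → ℂ}
    (hZ : ∀ s ≠ 0, HasSum (fun n => c n * s ^ n) (Z s)) :
    ∃ C, ∀ s : ℂ, s ≠ 0 → ‖s‖ ≤ 1 → ‖Z s - (c 0 + c 1 * s)‖ ≤ C * ‖s‖ ^ 2 := by
  -- Convergence at s = 1 already gives absolute summability of the coefficients.
  have h1 : Summable fun n => ‖c (n + 2)‖ := by
    have := (hZ 1 one_ne_zero).summable.norm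
    simp only [one_pow, mul_one] at this
    exact (summable_nat_add_iff 2).2 this
  refine ⟨∑' n, ‖c (n + 2)‖, fun s hs hs1 => ?_⟩
  have h2 := (hasSum_nat_add_iff' 2).2 (hZ s hs)
  simp only [Finset.sum_range_succ, Finset.sum_range_zero, zero_add, pow_zero, mul_one,
    pow_one] at h2
  rw [← h2.tsum_eq, ← tsum_mul_right]
  refine tsum_of_norm_bounded (h1.mul_right _).hasSum fun n => ?_
  rw [norm_mul, norm_pow, pow_add]
  have : ‖s‖ ^ n ≤ 1 := pow_le_one₀ (norm_nonneg _) hs1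
  gcongr
  nlinarith [sq_nonneg ‖s‖]

theorem exists_norm_hurwitzZetaFull_sub_le {u : ℝ} (hu : 0 < u) :
    ∃ C, ∀ s : ℂ, s ≠ 0 → ‖s‖ ≤ 1 →
      ‖hurwitzZetaFull u (1 + s) - 1 / s - (hurwitzStieltjes 0 u - hurwitzStieltjes 1 u * s)‖ ≤
        C * ‖s‖ ^ 2 := by
  have h := exists_norm_sub_affine_le
    (c := fun n => (-1) ^ n / (n.factorial : ℂ) * hurwitzStieltjes n u)
    (Z := fun s => hurwitzZetaFull u (1 + s) - 1 / s) fun s hs => by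
      simpa using hasSum_hurwitzStieltjes hu (s := 1 + s) (by simpa using hs)
  simpa [← sub_eq_add_neg] using h

theorem tendsto_hurwitzZetaFull_sub {u : ℝ} (hu : 0 < u) :
    Tendsto (fun s : ℝ => hurwitzZetaFull u (1 + s) - 1 / s) (𝓝[>] 0)
      (𝓝 (hurwitzStieltjes 0 u)) ∧
    Tendsto (fun s : ℝ => (hurwitzStieltjes 0 u - (hurwitzZetaFull u (1 + s) - 1 / s)) / s)
      (𝓝[>] 0) (𝓝 (hurwitzStieltjes 1 u)) := by
  obtain ⟨C, hC⟩ := exists_norm_hurwitzZetaFull_sub_le hu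
  have hid : Tendsto (fun s : ℝ => s) (𝓝[>] 0) (𝓝 0) := nhdsWithin_le_nhds
  have hidc : Tendsto (fun s : ℝ => (s : ℂ)) (𝓝[>] 0) (𝓝 0) := by
    simpa [Function.comp_def] using (Complex.continuous_ofReal.tendsto 0).comp hid
  have hbd : ∀ᶠ s : ℝ in 𝓝[>] 0, ‖(hurwitzStieltjes 0 u -
      (hurwitzZetaFull u (1 + s) - 1 / s)) / s - hurwitzStieltjes 1 u‖ ≤ C * s := by
    filter_upwards [Ioc_mem_nhdsGT (one_pos (α := ℝ))] with s hs
    have hs0 : (s : ℂ) ≠ 0 := by exact_mod_cast hs.1.ne'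
    have hn : ‖(s : ℂ)‖ = s := by rw [Complex.norm_real, Real.norm_of_nonneg hs.1.le]
    have h := hC s hs0 (by rw [hn]; exact hs.2)
    rw [hn] at h
    have e : (hurwitzStieltjes 0 u - (hurwitzZetaFull u (1 + s) - 1 / s)) / s -
        hurwitzStieltjes 1 u = -(hurwitzZetaFull u (1 + s) - 1 / s -
          (hurwitzStieltjes 0 u - hurwitzStieltjes 1 u * s)) / s := by
      field_simp
      ring
    rw [e, norm_div, norm_neg, hn, div_le_iff₀ hs.1]
    linarith
  have h2 : Tendsto (fun s : ℝ => (hurwitzStieltjes 0 u -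
      (hurwitzZetaFull u (1 + s) - 1 / s)) / s) (𝓝[>] 0) (𝓝 (hurwitzStieltjes 1 u)) := by
    rw [tendsto_iff_norm_sub_tendsto_zero]
    refine squeeze_zero' (Eventually.of_forall fun _ => norm_nonneg _) hbd ?_
    simpa using hid.const_mul C
  refine ⟨?_, h2⟩
  have h3 := (hidc.mul h2).const_sub (hurwitzStieltjes 0 u)
  rw [zero_mul, sub_zero] at h3
  refine h3.congr' ?_
  filter_upwards [self_mem_nhdsWithin] with s hs
  have hs0 : (s : ℂ) ≠ 0 := by exact_mod_cast (ne_of_gt hs : s ≠ 0)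
  rw [mul_div_cancel₀ _ hs0]
  ring

theorem tendsto_Gamma_add_one :
    Tendsto (fun s : ℝ => ((Real.Gamma (s + 1) : ℝ) : ℂ)) (𝓝[>] 0) (𝓝 1) := by
  have h : ContinuousAt Real.Gamma (0 + 1) :=
    (Real.differentiableAt_Gamma fun m => by linarith [m.cast_nonneg (α := ℝ)]).continuousAt
  have h2 : Tendsto (fun s : ℝ => Real.Gamma (s + 1)) (𝓝[>] 0) (𝓝 1) := by
    have := h.tendsto.comp ((tendsto_id.add_const (1 : ℝ)).mono_left
      (nhdsWithin_le_nhds (a := (0 : ℝ)) (s := Set.Ioi 0)))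
    simpa [Function.comp_def] using this
  simpa [Function.comp_def] using (Complex.continuous_ofReal.tendsto _).comp h2

/-- The Mellin identity is available only for s > 0, so the value at 0 is reached by computing the
limit s → 0⁺ in two ways. -/
theorem hurwitzRemainderMoment_zero {u : ℝ} (hu : 0 < u) :
    (hurwitzRemainderMoment u 0 : ℂ) = hurwitzStieltjes 0 u := by
  have h1 := (Complex.continuous_ofReal.tendsto _).comp (tendsto_hurwitzRemainderMoment hu)
  refine tendsto_nhds_unique h1 ?_
  have h2 := tendsto_Gamma_add_one.mul (tendsto_hurwitzZetaFull_sub hu).1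
  rw [one_mul] at h2
  refine h2.congr' ?_
  filter_upwards [self_mem_nhdsWithin] with s hs
  exact (hurwitzRemainderMoment_eq hu hs).symm

/-! ### Regularised integrals over the quadrant -/

/-- Lebesgue measure on the open first quadrant of the plane. -/
noncomputable def quadrantMeasure : Measure (ℝ × ℝ) :=
  (volume.restrict (Set.Ioi (0 : ℝ))).prod (volume.restrict (Set.Ioi (0 : ℝ)))

theorem quadrantMeasure_eq : quadrantMeasure =
    (volume.prod volume).restrict (Set.Ioi (0 : ℝ) ×ˢ Set.Ioi (0 : ℝ)) := by
  rw [quadrantMeasure, Measure.prod_restrict]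

theorem ae_quadrantMeasure : ∀ᵐ p ∂quadrantMeasure, 0 < p.1 ∧ 0 < p.2 := by
  rw [quadrantMeasure_eq]
  exact ae_restrict_mem (measurableSet_Ioi.prod measurableSet_Ioi)

theorem integrable_rpow_mul_hurwitzRemainder_add {u s : ℝ} (hu : 0 < u) (hs : 0 < s) :
    Integrable (fun p : ℝ × ℝ => p.1 ^ (s - 1) * hurwitzRemainder u (p.1 + p.2))
      quadrantMeasure := by
  have hc : 0 < min u 1 := lt_min hu one_pos
  have hb := ((integrableOn_rpow_mul_exp_neg_mul (s := s - 1) (by linarith) hc).mul_prod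
    (integrableOn_exp_neg_mul hc)).const_mul (1 + |u - 1|)
  refine Integrable.mono' hb ?_ ?_
  · exact ((measurable_fst.pow_const _).mul ((measurable_hurwitzRemainder u).comp
      (measurable_fst.add measurable_snd))).aestronglyMeasurable
  · filter_upwards [ae_quadrantMeasure] with p hp
    rw [norm_mul, Real.norm_of_nonneg (Real.rpow_nonneg hp.1.le _)]
    have h := abs_hurwitzRemainder_le (u := u) (add_pos hp.1 hp.2)
    have e : Real.exp (-(min u 1 * (p.1 + p.2))) =
        Real.exp (-(min u 1 * p.1)) * Real.exp (-(min u 1 * p.2)) := by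
      rw [← Real.exp_add]; congr 1; ring
    rw [e] at h
    calc _ ≤ p.1 ^ (s - 1) * ((1 + |u - 1|) *
          (Real.exp (-(min u 1 * p.1)) * Real.exp (-(min u 1 * p.2)))) :=
          mul_le_mul_of_nonneg_left h (Real.rpow_nonneg hp.1.le _)
      _ = _ := by ring

/-- The measure-preserving shear (b, a) ↦ (b, a + b) maps the quadrant to 0 < b < t; integrating
bˢ⁻¹ over that range gives tˢ/s. Indicators extend both sides to the whole plane, where the shear
acts. -/
theorem integral_rpow_mul_hurwitzRemainder_add {u s : ℝ} (hu : 0 < u) (hs : 0 < s) :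
    ∫ p, p.1 ^ (s - 1) * hurwitzRemainder u (p.1 + p.2) ∂quadrantMeasure =
      hurwitzRemainderMoment u s / s := by
  set g : ℝ × ℝ → ℝ := fun p => p.1 ^ (s - 1) * hurwitzRemainder u p.2 with hg
  set S : Set (ℝ × ℝ) := {p | 0 < p.1 ∧ p.1 < p.2} with hS
  have hemb : MeasurableEmbedding (fun z : ℝ × ℝ => (z.1, z.1 + z.2)) :=
    (MeasurableEquiv.shearAddRight ℝ).measurableEmbedding
  have hmp := measurePreserving_prod_add (volume : Measure ℝ) (volume : Measure ℝ)
  have hcomp : (S.indicator g) ∘ (fun z : ℝ × ℝ => (z.1, z.1 + z.2)) =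
      (Set.Ioi (0 : ℝ) ×ˢ Set.Ioi (0 : ℝ)).indicator
        (fun p => p.1 ^ (s - 1) * hurwitzRemainder u (p.1 + p.2)) := by
    ext p
    simp [Set.indicator_apply, hS, hg]
  have hQ : MeasurableSet (Set.Ioi (0 : ℝ) ×ˢ Set.Ioi (0 : ℝ)) :=
    measurableSet_Ioi.prod measurableSet_Ioi
  have hint : Integrable (S.indicator g) (volume.prod volume) := by
    rw [← hmp.integrable_comp_emb hemb, hcomp, integrable_indicator_iff hQ, IntegrableOn,
      ← quadrantMeasure_eq]
    exact integrable_rpow_mul_hurwitzRemainder_add hu hs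
  have hslice : ∀ t : ℝ, ∫ b, S.indicator g (b, t) =
      (Set.Ioi (0 : ℝ)).indicator (fun t => t ^ s * hurwitzRemainder u t / s) t := by
    intro t
    have e : (fun b => S.indicator g (b, t)) =
        (Set.Ioo 0 t).indicator (fun b => b ^ (s - 1) * hurwitzRemainder u t) := by
      ext b
      simp [Set.indicator_apply, hS, hg]
    rw [e, integral_indicator measurableSet_Ioo]
    by_cases ht : 0 < t
    · rw [Set.indicator_of_mem (Set.mem_Ioi.2 ht), integral_mul_const, ← integral_Ioc_eq_integral_Ioo,
        ← intervalIntegral.integral_of_le ht.le, integral_rpow (Or.inl (by linarith)),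
        sub_add_cancel, Real.zero_rpow hs.ne', sub_zero]
      ring
    · rw [Set.indicator_of_notMem (Set.notMem_Ioi.2 (not_lt.1 ht)), Set.Ioo_eq_empty ht]
      simp
  rw [quadrantMeasure_eq, ← integral_indicator hQ, ← hcomp]
  simp only [Function.comp_def]
  rw [hmp.integral_comp hemb, integral_prod_symm _ hint]
  simp_rw [hslice]
  rw [integral_indicator measurableSet_Ioi, integral_div, hurwitzRemainderMoment]

theorem measurable_hurwitzDifferenceKernel (u : ℝ) :
    Measurable fun p : ℝ × ℝ => hurwitzDifferenceKernel u p.1 p.2 :=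
  ((((measurable_hurwitzRemainder u).comp measurable_snd).mul
    (Real.measurable_exp.comp measurable_fst.neg)).sub ((measurable_hurwitzRemainder u).comp
      (measurable_snd.add measurable_fst))).div measurable_fst

theorem integrable_hurwitzDifferenceKernel {u : ℝ} (hu : 0 < u) :
    Integrable (fun p : ℝ × ℝ => hurwitzDifferenceKernel u p.1 p.2) quadrantMeasure := by
  have hc : 0 < min u 1 := lt_min hu one_pos
  obtain ⟨C, -, hK⟩ := exists_abs_hurwitzDifferenceKernel_le hu
  refine Integrable.mono' (((integrableOn_exp_neg_mul hc).mul_prod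
    (integrableOn_exp_neg_mul hc)).const_mul C)
    (measurable_hurwitzDifferenceKernel u).aestronglyMeasurable ?_
  filter_upwards [ae_quadrantMeasure] with p hp using hK p.1 p.2 hp.1 hp.2

theorem tendsto_integral_rpow_mul_hurwitzDifferenceKernel {u : ℝ} (hu : 0 < u) :
    Tendsto (fun s : ℝ => ∫ p, p.1 ^ s * hurwitzDifferenceKernel u p.1 p.2 ∂quadrantMeasure)
      (𝓝[>] 0) (𝓝 (∫ p, hurwitzDifferenceKernel u p.1 p.2 ∂quadrantMeasure)) := by
  have hc : 0 < min u 1 := lt_min hu one_pos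
  obtain ⟨C, hC, hK⟩ := exists_abs_hurwitzDifferenceKernel_le hu
  refine tendsto_integral_filter_of_dominated_convergence
    (fun p => C * ((1 + p.1) * Real.exp (-(min u 1 * p.1)) * Real.exp (-(min u 1 * p.2))))
    ?_ ?_ (((integrableOn_one_add_mul_exp_neg_mul hc).mul_prod
      (integrableOn_exp_neg_mul hc)).const_mul C) ?_
  · exact Eventually.of_forall fun s => ((measurable_fst.pow_const s).mul
      (measurable_hurwitzDifferenceKernel u)).aestronglyMeasurable
  · filter_upwards [Ioc_mem_nhdsGT (one_pos (α := ℝ))] with s hs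
    filter_upwards [ae_quadrantMeasure] with p hp
    rw [norm_mul, Real.norm_of_nonneg (Real.rpow_nonneg hp.1.le s)]
    calc _ ≤ (1 + p.1) *
          (C * (Real.exp (-(min u 1 * p.1)) * Real.exp (-(min u 1 * p.2)))) :=
          mul_le_mul (rpow_le_one_add hp.1 hs.1.le hs.2) (hK _ _ hp.1 hp.2)
            (abs_nonneg _) (by linarith [hp.1])
      _ = _ := by ring
  · filter_upwards [ae_quadrantMeasure] with p hp
    have h := (((Real.continuousAt_const_rpow (b := (0 : ℝ)) hp.1.ne').tendsto).mono_left
      (nhdsWithin_le_nhds (s := Set.Ioi 0))).mul_const (hurwitzDifferenceKernel u p.1 p.2)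
    rwa [Real.rpow_zero, one_mul] at h

/-- For s > 0 both halves are integrable separately: the first factors as Γ(s) M(0), the second is
the sheared integral M(s)/s. -/
theorem integral_rpow_mul_hurwitzDifferenceKernel {u s : ℝ} (hu : 0 < u) (hs : 0 < s) :
    ∫ p, p.1 ^ s * hurwitzDifferenceKernel u p.1 p.2 ∂quadrantMeasure =
      (Real.Gamma (s + 1) * hurwitzRemainderMoment u 0 - hurwitzRemainderMoment u s) / s := by
  have hR : IntegrableOn (hurwitzRemainder u) (Set.Ioi 0) := by
    simpa using integrableOn_rpow_mul_hurwitzRemainder (s := 0) hu (by norm_num)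
  have h1 : ∫ p, p.1 ^ s * hurwitzDifferenceKernel u p.1 p.2 ∂quadrantMeasure =
      ∫ p, ((Real.exp (-p.1) * p.1 ^ (s - 1)) * hurwitzRemainder u p.2 -
        p.1 ^ (s - 1) * hurwitzRemainder u (p.1 + p.2)) ∂quadrantMeasure := by
    refine integral_congr_ae ?_
    filter_upwards [ae_quadrantMeasure] with p hp
    rw [hurwitzDifferenceKernel, Real.rpow_sub_one hp.1.ne', add_comm p.2]
    ring
  have h2 : ∫ p, (Real.exp (-p.1) * p.1 ^ (s - 1)) * hurwitzRemainder u p.2 ∂quadrantMeasure =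
      Real.Gamma s * hurwitzRemainderMoment u 0 := by
    rw [Real.Gamma_eq_integral hs, hurwitzRemainderMoment, quadrantMeasure,
      integral_prod_mul (fun b : ℝ => Real.exp (-b) * b ^ (s - 1)) (hurwitzRemainder u)]
    simp
  have h3 : Integrable (fun p : ℝ × ℝ =>
      (Real.exp (-p.1) * p.1 ^ (s - 1)) * hurwitzRemainder u p.2) quadrantMeasure :=
    (Real.GammaIntegral_convergent hs).mul_prod hR
  rw [h1, integral_sub h3
    (integrable_rpow_mul_hurwitzRemainder_add hu hs), h2,
    integral_rpow_mul_hurwitzRemainder_add hu hs, Real.Gamma_add_one hs.ne']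
  field_simp

theorem integral_hurwitzDifferenceKernel {u : ℝ} (hu : 0 < u) :
    ((∫ p, hurwitzDifferenceKernel u p.1 p.2 ∂quadrantMeasure : ℝ) : ℂ) =
      hurwitzStieltjes 1 u := by
  have h1 := (Complex.continuous_ofReal.tendsto _).comp
    (tendsto_integral_rpow_mul_hurwitzDifferenceKernel hu)
  refine tendsto_nhds_unique h1 ?_
  have h2 := tendsto_Gamma_add_one.mul (tendsto_hurwitzZetaFull_sub hu).2
  rw [one_mul] at h2
  refine h2.congr' ?_
  filter_upwards [self_mem_nhdsWithin] with s hs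
  rw [Function.comp_apply, integral_rpow_mul_hurwitzDifferenceKernel hu hs, Complex.ofReal_div,
    Complex.ofReal_sub, Complex.ofReal_mul, hurwitzRemainderMoment_zero hu,
    hurwitzRemainderMoment_eq hu hs]
  ring

/-! ### Change of variables from the unit square to the quadrant -/

theorem map_exp_neg_withDensity :
    Measure.map (fun t : ℝ => Real.exp (-t))
      ((volume.restrict (Set.Ioi 0)).withDensity fun t => ENNReal.ofReal (Real.exp (-t))) =
      volume.restrict (Set.Ioo 0 1) := by
  have himg : (fun t : ℝ => Real.exp (-t)) '' Set.Ioi 0 = Set.Ioo 0 1 := by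
    ext x
    simp only [Set.mem_image, Set.mem_Ioi, Set.mem_Ioo]
    constructor
    · rintro ⟨t, ht, rfl⟩
      exact ⟨Real.exp_pos _, by linarith [one_sub_exp_neg_pos ht]⟩
    · rintro ⟨h0, h1⟩
      exact ⟨-Real.log x, by linarith [Real.log_neg h0 h1], by rw [neg_neg, Real.exp_log h0]⟩
  have hd : ∀ t ∈ Set.Ioi (0 : ℝ), HasDerivWithinAt (fun t : ℝ => Real.exp (-t))
      (-Real.exp (-t)) (Set.Ioi 0) t := fun t _ => by
    simpa using ((hasDerivAt_neg t).exp).hasDerivWithinAt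
  have h := map_withDensity_abs_det_fderiv_eq_addHaar volume measurableSet_Ioi.nullMeasurableSet
    (fun t ht => (hd t ht).hasFDerivWithinAt)
    (fun a _ b _ hab => neg_injective (Real.exp_injective hab))
  rw [himg] at h
  simpa only [ContinuousLinearMap.det_toSpanSingleton, abs_neg, Real.abs_exp] using h

theorem measurePreserving_exp_neg_prod :
    MeasurePreserving (Prod.map (fun t : ℝ => Real.exp (-t)) fun t : ℝ => Real.exp (-t))
      (quadrantMeasure.withDensity fun p =>
        ENNReal.ofReal (Real.exp (-p.1)) * ENNReal.ofReal (Real.exp (-p.2)))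
      ((volume.restrict (Set.Ioo 0 1)).prod (volume.restrict (Set.Ioo 0 1))) := by
  have hm : Measurable fun t : ℝ => Real.exp (-t) := by fun_prop
  have h1 : MeasurePreserving (fun t : ℝ => Real.exp (-t))
      ((volume.restrict (Set.Ioi 0)).withDensity fun t => ENNReal.ofReal (Real.exp (-t)))
      (volume.restrict (Set.Ioo 0 1)) := ⟨hm, map_exp_neg_withDensity⟩
  have h2 := h1.prod h1
  rwa [prod_withDensity hm.ennreal_ofReal hm.ennreal_ofReal] at h2

theorem measurableEmbedding_exp_neg_prod :
    MeasurableEmbedding (Prod.map (fun t : ℝ => Real.exp (-t)) fun t : ℝ => Real.exp (-t)) := by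
  have h : MeasurableEmbedding fun t : ℝ => Real.exp (-t) :=
    (Real.continuous_exp.comp continuous_neg).measurableEmbedding
      (Real.exp_injective.comp neg_injective)
  exact h.prodMap h

theorem integrable_unit_square_iff (f : ℝ × ℝ → ℝ) :
    Integrable f ((volume.restrict (Set.Ioo 0 1)).prod (volume.restrict (Set.Ioo 0 1))) ↔
      Integrable (fun p : ℝ × ℝ => Real.exp (-p.1) * Real.exp (-p.2) *
        f (Real.exp (-p.1), Real.exp (-p.2))) quadrantMeasure := by
  rw [← measurePreserving_exp_neg_prod.integrable_comp_emb measurableEmbedding_exp_neg_prod,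
    integrable_withDensity_iff_integrable_smul' (by fun_prop)
      (Eventually.of_forall fun p => ENNReal.mul_lt_top ENNReal.ofReal_lt_top
        ENNReal.ofReal_lt_top)]
  simp [ENNReal.toReal_mul, ENNReal.toReal_ofReal, Real.exp_nonneg, Prod.map]

theorem integral_unit_square_eq (f : ℝ × ℝ → ℝ) :
    ∫ p, f p ∂((volume.restrict (Set.Ioo 0 1)).prod (volume.restrict (Set.Ioo 0 1))) =
      ∫ p : ℝ × ℝ, Real.exp (-p.1) * Real.exp (-p.2) *
        f (Real.exp (-p.1), Real.exp (-p.2)) ∂quadrantMeasure := by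
  rw [← measurePreserving_exp_neg_prod.integral_comp measurableEmbedding_exp_neg_prod,
    integral_withDensity_eq_integral_toReal_smul (by fun_prop)
      (Eventually.of_forall fun p => ENNReal.mul_lt_top ENNReal.ofReal_lt_top
        ENNReal.ofReal_lt_top)]
  simp [ENNReal.toReal_mul, ENNReal.toReal_ofReal, Real.exp_nonneg, Prod.map]

/-- Since log(xy)/(log x log y) = -(1/a + 1/b), the first term splits between the two kernels. The
e⁻ᵗ/t parts contribute -2e⁻ᵃ⁻ᵇ/(ab) + e⁻ᵃ⁻ᵇ/(ab), which is the last term of the integrand. -/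
theorem stieltjesIntegrand_exp_neg {u a b : ℝ} (ha : 0 < a) (hb : 0 < b) :
    Real.exp (-a) * Real.exp (-b) * stieltjesIntegrand u (Real.exp (-a)) (Real.exp (-b)) =
      hurwitzDifferenceKernel u a b + hurwitzDifferenceKernel u b a := by
  have hp : ∀ t : ℝ, Real.exp (-t) ^ (u - 1) = Real.exp (-(u * t)) / Real.exp (-t) := fun t => by
    rw [← Real.exp_mul, ← Real.exp_sub]
    congr 1
    ring
  have hA := (one_sub_exp_neg_pos ha).ne'
  have hB := (one_sub_exp_neg_pos hb).ne'
  have hAB := (one_sub_exp_neg_pos (add_pos ha hb)).ne'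
  have e1 : Real.exp (-(a + b)) = Real.exp (-a) * Real.exp (-b) := by
    rw [← Real.exp_add]; congr 1; ring
  have e2 : Real.exp (-(u * (a + b))) = Real.exp (-(u * a)) * Real.exp (-(u * b)) := by
    rw [← Real.exp_add]; congr 1; ring
  simp only [stieltjesIntegrand, hurwitzDifferenceKernel, hurwitzRemainder]
  rw [add_comm b a, Real.mul_rpow (Real.exp_nonneg _) (Real.exp_nonneg _), hp, hp,
    Real.log_mul (Real.exp_pos _).ne' (Real.exp_pos _).ne', Real.log_exp, Real.log_exp, e1, e2]
  rw [e1] at hAB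
  have hA0 := (Real.exp_pos (-a)).ne'
  have hB0 := (Real.exp_pos (-b)).ne'
  have hab := (add_pos ha hb).ne'
  -- With the exponentials as independent unknowns, what remains is an identity of rational
  -- functions.
  generalize Real.exp (-a) = A at *
  generalize Real.exp (-b) = B at *
  generalize Real.exp (-(u * a)) = P at *
  generalize Real.exp (-(u * b)) = Q at *
  field_simp
  ring

theorem hurwitzDifferenceKernel_add_swap_ae (u : ℝ) :
    (fun p : ℝ × ℝ => Real.exp (-p.1) * Real.exp (-p.2) *
      stieltjesIntegrand u (Real.exp (-p.1)) (Real.exp (-p.2))) =ᵐ[quadrantMeasure]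
    fun p => hurwitzDifferenceKernel u p.1 p.2 + hurwitzDifferenceKernel u p.2 p.1 := by
  filter_upwards [ae_quadrantMeasure] with p hp using stieltjesIntegrand_exp_neg hp.1 hp.2

theorem integrable_hurwitzDifferenceKernel_swap {u : ℝ} (hu : 0 < u) :
    Integrable (fun p : ℝ × ℝ => hurwitzDifferenceKernel u p.2 p.1) quadrantMeasure :=
  (integrable_hurwitzDifferenceKernel hu).swap

theorem integrable_stieltjesIntegrand {u : ℝ} (hu : 0 < u) :
    Integrable (fun p : ℝ × ℝ => stieltjesIntegrand u p.1 p.2)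
      ((volume.restrict (Set.Ioo 0 1)).prod (volume.restrict (Set.Ioo 0 1))) := by
  rw [integrable_unit_square_iff, integrable_congr (hurwitzDifferenceKernel_add_swap_ae u)]
  exact (integrable_hurwitzDifferenceKernel hu).add (integrable_hurwitzDifferenceKernel_swap hu)

theorem integral_stieltjesIntegrand {u : ℝ} (hu : 0 < u) :
    ∫ y in (0 : ℝ)..1, ∫ x in (0 : ℝ)..1, stieltjesIntegrand u x y =
      2 * ∫ p, hurwitzDifferenceKernel u p.1 p.2 ∂quadrantMeasure := by
  have hswap : ∫ p, hurwitzDifferenceKernel u p.2 p.1 ∂quadrantMeasure =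
      ∫ p, hurwitzDifferenceKernel u p.1 p.2 ∂quadrantMeasure :=
    integral_prod_swap fun p : ℝ × ℝ => hurwitzDifferenceKernel u p.1 p.2
  simp only [intervalIntegral.integral_of_le zero_le_one, integral_Ioc_eq_integral_Ioo]
  -- The inner integral runs over x, the first coordinate, hence the symmetric form of Fubini.
  rw [← integral_prod_symm _ (integrable_stieltjesIntegrand hu), integral_unit_square_eq,
    integral_congr_ae (hurwitzDifferenceKernel_add_swap_ae u),
    integral_add (integrable_hurwitzDifferenceKernel hu)
      (integrable_hurwitzDifferenceKernel_swap hu), hswap]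
  ring

/-! ### The case u = 1 and the conclusion -/

theorem stieltjesIntegrandOne_eq : stieltjesIntegrandOne = stieltjesIntegrand 1 := by
  ext x y
  simp [stieltjesIntegrandOne, stieltjesIntegrand]

/-- The correction sum is empty because ⌈1⌉ - 1 = 0, and 1 is the period, so its class is 0. -/
theorem hurwitzZetaFull_one : hurwitzZetaFull 1 = riemannZeta := by
  ext s
  have h : ((1 : ℝ) : UnitAddCircle) = 0 := AddCircle.coe_period 1
  simp [hurwitzZetaFull, h, HurwitzZeta.hurwitzZeta_zero]

theorem stieltjesConstant_eq (n : ℕ) : stieltjesConstant n = hurwitzStieltjes n 1 := by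
  rw [stieltjesConstant, hurwitzStieltjes, hurwitzZetaFull_one]

theorem integrableOn_stieltjesIntegrand {u : ℝ} (hu : 0 < u) :
    IntegrableOn (fun p : ℝ × ℝ => stieltjesIntegrand u p.1 p.2)
      (Set.Ioo (0 : ℝ) 1 ×ˢ Set.Ioo (0 : ℝ) 1) := by
  rw [IntegrableOn, Measure.volume_eq_prod, ← Measure.prod_restrict]
  exact integrable_stieltjesIntegrand hu

theorem hurwitzStieltjes_one_eq {u : ℝ} (hu : 0 < u) :
    hurwitzStieltjes 1 u =
      ((1 / 2 * ∫ y in (0 : ℝ)..1, ∫ x in (0 : ℝ)..1, stieltjesIntegrand u x y : ℝ) : ℂ) := by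
  rw [integral_stieltjesIntegrand hu, ← integral_hurwitzDifferenceKernel hu]
  push_cast
  ring

theorem stieltjesIntegrandOne_comm (x y : ℝ) :
    stieltjesIntegrandOne x y = stieltjesIntegrandOne y x := by
  simp only [stieltjesIntegrandOne]
  rw [mul_comm y x, mul_right_comm _ (Real.log y) (Real.log x),
    mul_comm (Real.log y) (Real.log x)]
  ring

theorem mainTheorem7 :
    (∀ u : ℝ, 0 < u →
      IntegrableOn (fun p : ℝ × ℝ => stieltjesIntegrand u p.1 p.2)
        (Set.Ioo (0 : ℝ) 1 ×ˢ Set.Ioo (0 : ℝ) 1) ∧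
      hurwitzStieltjes 1 u =
        ((1 / 2 * ∫ y in (0 : ℝ)..1, ∫ x in (0 : ℝ)..1, stieltjesIntegrand u x y : ℝ) : ℂ)) ∧
    (IntegrableOn (fun p : ℝ × ℝ => stieltjesIntegrandOne p.1 p.2)
        (Set.Ioo (0 : ℝ) 1 ×ˢ Set.Ioo (0 : ℝ) 1) ∧
      stieltjesConstant 1 =
        ((1 / 2 * ∫ y in (0 : ℝ)..1, ∫ x in (0 : ℝ)..1, stieltjesIntegrandOne x y : ℝ) : ℂ) ∧
      ∀ x y : ℝ, stieltjesIntegrandOne x y = stieltjesIntegrandOne y x) := by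
  refine ⟨fun u hu => ⟨integrableOn_stieltjesIntegrand hu, hurwitzStieltjes_one_eq hu⟩, ?_, ?_,
    stieltjesIntegrandOne_comm⟩
  · rw [stieltjesIntegrandOne_eq]
    exact integrableOn_stieltjesIntegrand one_pos
  · rw [stieltjesIntegrandOne_eq, stieltjesConstant_eq]
    exact hurwitzStieltjes_one_eq one_pos
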